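/- For a poset $P$, let $\mathrm{Ht}(P)$ denote its height, the supremum (a cardinal) of the cardinalities of chains in $P$. For a semigroup $S$, let $\mathrm{LCong}(S)$, $\mathrm{RCong}(S)$ and $\mathrm{Cong}(S)$ be the lattices, under inclusion, of left, right and two-sided congruences of $S$, and let $E(X)$ be the set of idempotents in $X\subseteq S$. For a group $G$, let $\mathrm{Sub}(G)$ and $\mathrm{NSub}(G)$ be the lattices of subgroups and of normal subgroups of $G$. Let $\mathscr L,\mathscr R,\mathscr J,\mathscr H=\mathscr L\cap\mathscr R,\mathscr D=\mathscr L\vee\mathscr R$ be Green's relations. The semigroup $S$ is $\mathscr H$-trivial if $\mathscr H$ is equality, and stable if for all $x,s\in S$: $x\mathrel{\mathscr J}sx$ implies $x\mathrel{\mathscr L}sx$, and $x\mathrel{\mathscr J}xs$ implies $x\mathrel{\mathscr R}xs$. The Schützenberger group of an $\mathscr H$-class $H$ is the group of permutations of $H$ of the form $h\mapsto th$, where $t\in S^1$ and $tH\subseteq H$ (up to isomorphism, it is the same for all $\mathscr H$-classes in a $\mathscr D$-class, and it is isomorphic to $H$ if $H$ is a maximal subgroup of $S$). Let $S$ be a non-empty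 inverse semigroup with finitely many $\mathscr D$-classes $D_1,\dots,D_n$, and let $\Gamma_r$ be the Schützenberger group of an (arbitrary) $\mathscr H$-class contained in $D_r$, for $1\le r\le n$. (i) If each $D_r$ has only finitely many idempotents, then $$\mathrm{Ht}(\mathrm{LCong}(S))=\mathrm{Ht}(\mathrm{RCong}(S))=\sum_{r=1}^n |E(D_r)|\cdot\mathrm{Ht}(\mathrm{Sub}(\Gamma_r)).$$ Moreover, this is equal to $|E(S)|$ if $S$ is $\mathscr H$-trivial. (ii) If $S$ is stable, then $$\mathrm{Ht}(\mathrm{Cong}(S))=\sum_{r=1}^n \mathrm{Ht}(\mathrm{NSub}(\Gamma_r)).$$ Moreover, this is equal to $n=|S/\mathscr D|$ if $S$ is $\mathscr H$-trivial. -/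

import Mathlib

universe u

namespace SemigroupHeight

/-- The height of a poset: the supremum of the cardinalities of its chains. -/
noncomputable def height (P : Type u) [PartialOrder P] : Cardinal.{u} :=
  ⨆ C : {C : Set P // IsChain (· ≤ ·) C}, Cardinal.mk C.1

section Semigroups

variable (S : Type u) [Semigroup S]

/-- The lattice of left congruences of `S`, ordered by inclusion. -/
abbrev LCong : Type u := {r : Setoid S // ∀ a x y : S, r x y → r (a * x) (a * y)}

/-- The lattice of right congruences of `S`, ordered by inclusion. -/
abbrev RCong : Type u := {r : Setoid S // ∀ a x y : S, r x y → r (x * a) (y * a)}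

/-- `S` is an inverse semigroup: every element `x` has a unique inverse, that is, a unique `y`
with `x y x = x` and `y x y = y`. -/
def IsInverseSemigroup : Prop := ∀ x : S, ∃! y : S, x * y * x = x ∧ y * x * y = y

/-- The set of idempotents of `S`. -/
def idempotents : Set S := {e : S | IsIdempotentElem e}

end Semigroups

section Green

variable {S : Type u} [Semigroup S]

/-- `x ≤_L y`, that is, `x ∈ S¹ y`. Here and below `S¹` is `WithOne S`; adjoining an identity to a
semigroup that already has one changes none of the notions defined with it. -/
def leL (x y : S) : Prop := ∃ s : WithOne S, (x : WithOne S) = s * y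

/-- `x ≤_R y`, that is, `x ∈ y S¹`. -/
def leR (x y : S) : Prop := ∃ s : WithOne S, (x : WithOne S) = y * s

/-- `x ≤_J y`, that is, `x ∈ S¹ y S¹`. -/
def leJ (x y : S) : Prop := ∃ s t : WithOne S, (x : WithOne S) = s * y * t

theorem leL_refl (x : S) : leL x x := ⟨1, (one_mul _).symm⟩

theorem leR_refl (x : S) : leR x x := ⟨1, (mul_one _).symm⟩

theorem leJ_refl (x : S) : leJ x x := ⟨1, 1, by simp⟩

theorem leL_trans {x y z : S} : leL x y → leL y z → leL x z := by
  rintro ⟨s, hs⟩ ⟨t, ht⟩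
  exact ⟨s * t, by rw [hs, ht, mul_assoc]⟩

theorem leR_trans {x y z : S} : leR x y → leR y z → leR x z := by
  rintro ⟨s, hs⟩ ⟨t, ht⟩
  exact ⟨t * s, by rw [hs, ht, mul_assoc]⟩

theorem leJ_trans {x y z : S} : leJ x y → leJ y z → leJ x z := by
  rintro ⟨s, t, hs⟩ ⟨p, q, hp⟩
  exact ⟨s * p, q * t, by rw [hs, hp]; simp only [mul_assoc]⟩

variable (S)

/-- Green's relation `L`. -/
def greenL : Setoid S where
  r x y := leL x y ∧ leL y x
  iseqv := ⟨fun x => ⟨leL_refl x, leL_refl x⟩, fun h => ⟨h.2, h.1⟩,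
    fun h k => ⟨leL_trans h.1 k.1, leL_trans k.2 h.2⟩⟩

/-- Green's relation `R`. -/
def greenR : Setoid S where
  r x y := leR x y ∧ leR y x
  iseqv := ⟨fun x => ⟨leR_refl x, leR_refl x⟩, fun h => ⟨h.2, h.1⟩,
    fun h k => ⟨leR_trans h.1 k.1, leR_trans k.2 h.2⟩⟩

/-- Green's relation `J`. -/
def greenJ : Setoid S where
  r x y := leJ x y ∧ leJ y x
  iseqv := ⟨fun x => ⟨leJ_refl x, leJ_refl x⟩, fun h => ⟨h.2, h.1⟩,
    fun h k => ⟨leJ_trans h.1 k.1, leJ_trans k.2 h.2⟩⟩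

/-- Green's relation `H`, the intersection of `L` and `R`. -/
def greenH : Setoid S := greenL S ⊓ greenR S

/-- Green's relation `D`, the join of `L` and `R` in the lattice of equivalence relations. -/
def greenD : Setoid S := greenL S ⊔ greenR S

/-- The set `S/D` of `D`-classes of `S`. -/
abbrev DClass : Type u := Quotient (greenD S)

/-- `S` is stable: every `J`-class is stable. (Multiplication by the adjoined identity need not be
mentioned, as `L` and `R` are reflexive.) -/
def IsStable : Prop :=
  (∀ x s : S, greenJ S x (s * x) → greenL S x (s * x)) ∧
  (∀ x s : S, greenJ S x (x * s) → greenR S x (x * s))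

/-- `S` is `H`-trivial: Green's relation `H` is equality. -/
def IsHTrivial : Prop := ∀ x y : S, greenH S x y → x = y

variable {S}

/-- The idempotents that lie in the `D`-class `D`. -/
def idempotentsIn (D : DClass S) : Set S :=
  {e : S | IsIdempotentElem e ∧ (Quotient.mk (greenD S) e : DClass S) = D}

/-- The `H`-class of `x`. -/
def hClass (x : S) : Set S := {y : S | greenH S y x}

/-- The (left) Schützenberger group of the `H`-class `H` of `x`: the group, under composition, of
all permutations `h ↦ t h` of `H` that are induced by left translations by elements `t` of `S¹`
that map `H` to itself. -/
def schutzenbergerGroup (x : S) : Subgroup (Equiv.Perm (hClass x)) where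
  carrier := {σ | ∃ t : WithOne S, ∀ h : hClass x, ((σ h : S) : WithOne S) = t * (h : S)}
  one_mem' := ⟨1, fun h => by simp⟩
  mul_mem' := by
    rintro σ τ ⟨s, hs⟩ ⟨t, ht⟩
    exact ⟨s * t, fun h => by rw [Equiv.Perm.mul_apply, hs, ht, mul_assoc]⟩
  inv_mem' := by
    rintro σ ⟨t, ht⟩
    let x₀ : hClass x := ⟨x, (greenH S).refl x⟩
    have h1 : greenH S (x₀ : S) (σ x₀ : S) :=
      (greenH S).trans x₀.2 ((greenH S).symm (σ x₀).2)
    obtain ⟨s, hs⟩ := h1.1.1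
    have key : ∀ h : hClass x, s * (t * ((h : S) : WithOne S)) = ((h : S) : WithOne S) := by
      intro h
      obtain ⟨v, hv⟩ := (show greenH S (h : S) x from h.2).2.1
      have hx : s * (t * ((x₀ : S) : WithOne S)) = ((x₀ : S) : WithOne S) := by
        rw [← ht x₀, ← hs]
      rw [hv, ← mul_assoc t, ← mul_assoc s]
      exact congrArg (· * v) hx
    refine ⟨s, fun h => ?_⟩
    have h2 := key (σ⁻¹ h)
    rw [← ht (σ⁻¹ h), show σ (σ⁻¹ h) = h from σ.apply_symm_apply h] at h2
    exact h2.symm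

end Green

/-- The lattice of normal subgroups of a group `G`, ordered by inclusion. -/
abbrev NSub (G : Type u) [Group G] : Type u := {N : Subgroup G // N.Normal}

end SemigroupHeight

open SemigroupHeight

/-!
Both formulas count how a chain of congruences can grow on finitely many layers. For left
congruences the layers are the `L`-classes, of which there is one for each idempotent; for two-sided
congruences of a stable semigroup they are the `D`-classes, which are the `J`-classes. The layers are
put into a linear order that refines the natural one, so that multiplication never moves an element
to a higher layer.

A congruence `ρ` either collapses a layer, relating all of its elements to elements of lower layers,
or relates none of them to such elements. In the second case the restriction of `ρ` to the layer is
determined by a trace: a subgroup (normal subgroup, for two-sided congruences) of the maximal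
subgroup of the `D`-class, which is the Schützenberger group (`schutzenbergerEquiv`). This is where
finiteness of the set of idempotents (`mul_inv_eq_of_le`, `leftTrace_determines`) or stability
(`conTrace_determines`) enters. If `ρ ≤ σ` collapse the same layers and have the same traces on the
others, then `ρ = σ`, since every element is `ρ`-related to one in an uncollapsed layer. So each step
of a chain changes a trace or collapses a layer. The lowest layer never collapses; this makes up for
the one value "collapsed" that each other layer has on top of its traces, and a chain is not larger
than the union of the chains of its traces (`mk_chain_le_sum`, `height_le_sum_of_layers`).

Conversely, for a layer `k` and a subgroup `N` there is a congruence that collapses everything below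
`k`, is trivial above `k` and has trace `N` at `k`: the syntactic congruence of the copy of `N`,
restricted to the layers up to `k` (`leftFam`, `conFam`). These congruences increase with `N` and,
layer by layer, with `k`; their only coincidence, the full congruence on the lowest layer, is made
good by the universal congruence on the whole of `S` (`sum_le_height_of_layers`).

All heights are cardinals and may be infinite suprema that are not attained, so the sums are compared
chain by chain (`sum_height_le`).
-/

universe v w

namespace SemigroupHeight

/-! ### Chains and heights -/

section Order

open Cardinal

theorem mk_le_height {P : Type u} [PartialOrder P] {C : Set P} (hC : IsChain (· ≤ ·) C) :
    #C ≤ height P :=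
  le_ciSup (f := fun C : {C : Set P // IsChain (· ≤ ·) C} => #C.1)
    Cardinal.bddAbove_of_small ⟨C, hC⟩

theorem height_le {P : Type u} [PartialOrder P] {c : Cardinal.{u}}
    (h : ∀ C : Set P, IsChain (· ≤ ·) C → #C ≤ c) : height P ≤ c :=
  ciSup_le' fun C => h C.1 C.2

theorem height_le_of_orderIso {P Q : Type u} [PartialOrder P] [PartialOrder Q] (e : P ≃o Q) :
    height P ≤ height Q := by
  refine height_le fun C hC => ?_
  rw [← Cardinal.mk_image_eq (s := C) e.injective]
  refine mk_le_height ?_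
  rintro _ ⟨x, hx, rfl⟩ _ ⟨y, hy, rfl⟩ _
  simpa using hC.total hx hy

theorem height_congr {P Q : Type u} [PartialOrder P] [PartialOrder Q] (e : P ≃o Q) :
    height P = height Q :=
  (height_le_of_orderIso e).antisymm (height_le_of_orderIso e.symm)

theorem height_of_subsingleton {P : Type u} [PartialOrder P] [Subsingleton P] [Nonempty P] :
    height P = 1 := by
  apply le_antisymm
  · exact height_le fun C _ => Cardinal.le_one_iff_subsingleton.2 inferInstance
  · obtain ⟨x⟩ := ‹Nonempty P›
    simpa using mk_le_height (IsChain.singleton (r := (· ≤ ·)) (a := x))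

theorem mk_sigma_of_fintype {ι : Type u} [Fintype ι] (f : ι → Type u) :
    #(Σ k, f k) = ∑ k, #(f k) := by
  classical
  have H : ∀ s : Finset ι, #{z : Σ k, f k | z.1 ∈ s} = ∑ k ∈ s, #(f k) := by
    intro s
    induction s using Finset.induction_on with
    | empty => simp
    | insert a s ha ih =>
      have h1 : {z : Σ k, f k | z.1 ∈ insert a s}
          = Set.range (Sigma.mk a) ∪ {z : Σ k, f k | z.1 ∈ s} := by
        ext ⟨k, z⟩
        simp only [Finset.mem_insert, Set.mem_ofPred_eq, Set.mem_union, Set.mem_range]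
        refine or_congr_left ⟨?_, ?_⟩
        · rintro rfl
          exact ⟨z, rfl⟩
        · rintro ⟨y, hy⟩
          exact (congrArg Sigma.fst hy).symm
      rw [h1, Cardinal.mk_union_of_disjoint, ih, Finset.sum_insert ha,
        Cardinal.mk_range_eq _ sigma_mk_injective]
      rw [Set.disjoint_left]
      rintro _ ⟨y, rfl⟩ hy
      exact ha hy
  rw [← H Finset.univ]
  simp

theorem sum_ciSup_le {ι : Type v} {I : ι → Type u} [∀ k, Nonempty (I k)]
    (f : ∀ k, I k → Cardinal.{u}) (s : Finset ι) (c : Cardinal.{u})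
    (h : ∀ i : ∀ k, I k, ∑ k ∈ s, f k (i k) ≤ c) : ∑ k ∈ s, ⨆ i, f k i ≤ c := by
  classical
  -- In each partial sum of suprema the summands over `t` are replaced by suprema one at a time.
  suffices H : ∀ t ⊆ s, ∀ i : ∀ k, I k,
      ∑ k ∈ t, (⨆ i, f k i) + ∑ k ∈ s \ t, f k (i k) ≤ c by
    simpa using H s subset_rfl fun k => Classical.arbitrary _
  intro t
  induction t using Finset.induction_on with
  | empty => intro _ i; simpa using h i
  | insert a t ha ih =>
    intro hts i
    have has : a ∈ s := hts (Finset.mem_insert_self _ _)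
    rw [Finset.sum_insert ha, add_assoc, Cardinal.ciSup_add _ Cardinal.bddAbove_of_small]
    refine ciSup_le' fun j => ?_
    have h1 := ih ((Finset.subset_insert _ _).trans hts) (Function.update i a j)
    have h2 : s \ t = insert a (s \ insert a t) := by grind
    rw [h2, Finset.sum_insert (by simp), Function.update_self] at h1
    have h3 : ∑ k ∈ s \ insert a t, f k (Function.update i a j k)
        = ∑ k ∈ s \ insert a t, f k (i k) :=
      Finset.sum_congr rfl fun k hk => by
        rw [Function.update_of_ne]
        rintro rfl
        simp at hk
    rw [h3] at h1
    rwa [add_left_comm]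

/-- A finite sum of heights is bounded by every cardinal that bounds the sums of the cardinalities
of chains; the heights themselves need not be attained. -/
theorem sum_height_le {ι : Type v} [Fintype ι] {Q : ι → Type u} [∀ k, PartialOrder (Q k)]
    {c : Cardinal.{u}}
    (h : ∀ C : ∀ k, Set (Q k), (∀ k, IsChain (· ≤ ·) (C k)) → ∑ k, #(C k) ≤ c) :
    ∑ k, height (Q k) ≤ c :=
  haveI : ∀ k, Nonempty {C : Set (Q k) // IsChain (· ≤ ·) C} := fun _ => ⟨⟨∅, IsChain.empty⟩⟩
  sum_ciSup_le (fun k (C : {C : Set (Q k) // IsChain (· ≤ ·) C}) => #C.1) Finset.univ c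
    fun i => h (fun k => (i k).1) fun k => (i k).2

/-- If a chain `C` is separated by finitely many monotone functions `tr k`, each of which is only
recorded up to the moment when a monotone condition `col k` sets in, and if `col k₀` never holds on
`C`, then `C` has at most as many elements as all the sets of recorded values together. -/
theorem mk_chain_le_sum {P : Type u} [PartialOrder P] {ι : Type u} [Fintype ι]
    {Q : ι → Type u} [∀ k, PartialOrder (Q k)] (tr : ∀ k, P → Q k) (col : ι → P → Prop)
    (tr_mono : ∀ k, Monotone (tr k)) (col_mono : ∀ k, Monotone (col k))
    (sep : ∀ p q : P, p ≤ q → (∀ k, col k q → col k p) →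
      (∀ k, ¬ col k q → tr k p = tr k q) → p = q)
    {C : Set P} (hC : IsChain (· ≤ ·) C) (k₀ : ι) (hk₀ : ∀ p ∈ C, ¬ col k₀ p) :
    #C ≤ ∑ k, #(tr k '' {p ∈ C | ¬ col k p}) := by
  classical
  set D : ∀ k, Set (Q k) := fun k => tr k '' {p ∈ C | ¬ col k p} with hD
  have hsum : ∑ k, #(D k) = #(Σ k, D k) :=
    (mk_sigma_of_fintype _).symm
  change #C ≤ ∑ k, #(D k)
  rw [hsum]
  rcases finite_or_infinite (Σ k, D k) with hfin | hinf
  · -- The sets `G p` increase strictly along `C`, and none of them is everything.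
    have := Fintype.ofFinite (Σ k, D k)
    let G : P → Finset (Σ k, D k) := fun p => {z | col z.1 p ∨ (z.2 : Q z.1) < tr z.1 p}
    have Gss : ∀ p ∈ C, ∀ q ∈ C, p < q → G p ⊂ G q := by
      intro p hp q hq hpq
      refine ⟨fun z hz => ?_, fun hGG => hpq.ne ?_⟩
      · simp only [G, Finset.mem_filter, Finset.mem_univ, true_and] at hz ⊢
        exact hz.imp (col_mono _ hpq.le) fun hz => hz.trans_le (tr_mono _ hpq.le)
      · have hmem : ∀ z : Σ k, D k, col z.1 q ∨ (z.2 : Q z.1) < tr z.1 q →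
            col z.1 p ∨ (z.2 : Q z.1) < tr z.1 p := fun z hz => by
          have := @hGG z (by simpa [G] using hz)
          simpa [G] using this
        have hcol : ∀ k, col k q → col k p := fun k hk => by
          by_contra hkp
          have := hmem ⟨k, tr k p, p, ⟨hp, hkp⟩, rfl⟩ (Or.inl hk)
          exact this.elim hkp (lt_irrefl _)
        refine sep p q hpq.le hcol fun k hk => ?_
        have hkp : ¬ col k p := fun h => hk (col_mono k hpq.le h)
        by_contra hne
        have := hmem ⟨k, tr k p, p, ⟨hp, hkp⟩, rfl⟩
          (Or.inr (lt_of_le_of_ne (tr_mono k hpq.le) hne))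
        exact this.elim hkp (lt_irrefl _)
    have Glt : ∀ p ∈ C, (G p).card < Fintype.card (Σ k, D k) := by
      intro p hp
      refine Finset.card_lt_univ_of_notMem (x := ⟨k₀, tr k₀ p, p, ⟨hp, hk₀ p hp⟩, rfl⟩) ?_
      simp [G, hk₀ p hp]
    let F : C → Fin (Fintype.card (Σ k, D k)) := fun p => ⟨(G p).card, Glt p p.2⟩
    have hF : Function.Injective F := by
      intro p q hpq
      have hcard : (G p).card = (G q).card := congrArg Fin.val hpq
      by_contra hne
      have hne' : (p : P) ≠ q := fun h => hne (Subtype.ext h)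
      rcases hC.total p.2 q.2 with h | h
      · exact (Finset.card_lt_card (Gss p p.2 q q.2 (lt_of_le_of_ne h hne'))).ne hcard
      · exact (Finset.card_lt_card (Gss q q.2 p p.2 (lt_of_le_of_ne h hne'.symm))).ne' hcard
    have := Cardinal.lift_mk_le_lift_mk_of_injective hF
    simpa using this
  · -- Here `C` embeds into a finite product of sets that are not larger than the infinite union.
    let F : C → ∀ k, Option (D k) := fun p k =>
      if hk : col k p then none else some ⟨tr k p, p, ⟨p.2, hk⟩, rfl⟩
    have hFc : ∀ (p q : C), F p = F q → ∀ k, col k q → col k p := by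
      intro p q hpq k hk
      by_contra hkp
      have := congrFun hpq k
      simp [F, hk, hkp] at this
    have hFt : ∀ (p q : C), F p = F q → ∀ k, ¬ col k q → tr k p = tr k q := by
      intro p q hpq k hk
      have hkp : ¬ col k p := fun h => hk (hFc q p hpq.symm k h)
      have := congrFun hpq k
      simp only [F, dif_neg hk, dif_neg hkp, Option.some.injEq] at this
      exact congrArg Subtype.val this
    have hF : Function.Injective F := by
      intro p q hpq
      rcases hC.total p.2 q.2 with h | h
      · exact Subtype.ext (sep p q h (hFc p q hpq) (hFt p q hpq))
      · exact (Subtype.ext (sep q p h (hFc q p hpq.symm) (hFt q p hpq.symm))).symm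
    have hinf' : ℵ₀ ≤ #(Σ k, D k) := Cardinal.infinite_iff.1 hinf
    calc #C ≤ #(∀ k, Option (D k)) := Cardinal.mk_le_of_injective hF
      _ = Cardinal.prod fun k => #(Option (D k)) := Cardinal.mk_pi _
      _ ≤ Cardinal.prod fun _ : ι => #(Σ k, D k) := by
        refine Cardinal.prod_le_prod _ _ fun k => ?_
        rw [Cardinal.mk_option]
        refine Cardinal.add_le_of_le hinf' ?_ (Cardinal.one_le_aleph0.trans hinf')
        exact Cardinal.mk_le_of_injective (f := fun d => (⟨k, d⟩ : Σ k, D k))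
          fun a b hab => by simpa using hab
      _ = #(Σ k, D k) ^ (Fintype.card ι) := by simp
      _ ≤ #(Σ k, D k) := Cardinal.power_nat_le hinf'

end Order

theorem exists_linearOrder_extending {ι : Type u} (r : ι → ι → Prop) [IsPartialOrder ι r] :
    ∃ l : LinearOrder ι, ∀ a b, r a b → l.le a b := by
  classical
  obtain ⟨s, hs, h⟩ := extend_partialOrder r
  exact ⟨{
    le := s
    le_refl := hs.refl
    le_trans := hs.trans
    le_antisymm := hs.antisymm
    le_total := hs.total
    toDecidableLE := Classical.decRel _ }, h⟩

section Layers

open Cardinal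

variable {X : Type w} {P ι : Type u} [PartialOrder P] [LinearOrder ι] {Q : ι → Type u}
  [∀ k, PartialOrder (Q k)]

/-- The layer `k` of `cls` collapses under the equivalence `r` if some element of it is related to
an element of a lower layer. -/
def Collapses {X : Type v} {ι : Type w} [LT ι] (cls : X → ι) (k : ι) (r : Setoid X) : Prop :=
  ∃ x y, cls x = k ∧ cls y < k ∧ r x y

/-- Upper bound for the height of a poset `P` of equivalences on a set with finitely many layers:
if collapsing affects a layer as a whole, and if on a layer that does not collapse an equivalence is
determined by its trace, then every chain is separated by the traces on its uncollapsed layers. -/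
theorem height_le_sum_of_layers [Fintype ι] [Nonempty ι] (toS : P ↪o Setoid X) (cls : X → ι)
    (tr : ∀ k, P → Q k) (tr_mono : ∀ k, Monotone (tr k))
    (spread : ∀ (p : P) (x x' y : X), cls x = cls x' → cls y < cls x → toS p x y →
      ∃ y', cls y' < cls x' ∧ toS p x' y')
    (det : ∀ k (p q : P), p ≤ q → ¬ Collapses cls k (toS q) → tr k p = tr k q →
      ∀ x y, cls x = k → cls y = k → toS q x y → toS p x y) :
    height P ≤ ∑ k, height (Q k) := by
  obtain ⟨k₀, hk₀⟩ := Finite.exists_min (id : ι → ι)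
  refine height_le fun C hC => ?_
  have col_mono : ∀ k, Monotone fun p : P => Collapses cls k (toS p) := by
    rintro k p q hpq ⟨x, y, hx, hy, h⟩
    exact ⟨x, y, hx, hy, toS.monotone hpq h⟩
  refine (mk_chain_le_sum tr (fun k p => Collapses cls k (toS p)) tr_mono col_mono ?_ hC k₀
    ?_).trans ?_
  · intro p q hpq hcol htr
    -- Every element is `p`-related to one in a layer that does not collapse.
    have reach : ∀ k, ∀ x, cls x = k →
        ∃ x', ¬ Collapses cls (cls x') (toS p) ∧ toS p x x' := by
      intro k
      induction k using WellFoundedLT.induction with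
      | _ k ih =>
        rintro x rfl
        by_cases hx : Collapses cls (cls x) (toS p)
        · obtain ⟨z, y, hz, hy, hzy⟩ := hx
          obtain ⟨y', hy', hxy'⟩ := spread p z x y hz (hz ▸ hy) hzy
          obtain ⟨x', h1, h2⟩ := ih _ hy' y' rfl
          exact ⟨x', h1, (toS p).trans hxy' h2⟩
        · exact ⟨x, hx, (toS p).refl x⟩
    apply le_antisymm hpq
    rw [← toS.le_iff_le]
    intro x y hxy
    obtain ⟨x', hx', hxx'⟩ := reach _ x rfl
    obtain ⟨y', hy', hyy'⟩ := reach _ y rfl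
    have hq : toS q x' y' :=
      (toS q).trans ((toS q).symm (toS.monotone hpq hxx'))
        ((toS q).trans hxy (toS.monotone hpq hyy'))
    have hxq : ¬ Collapses cls (cls x') (toS q) := fun h => hx' (hcol _ h)
    have hyq : ¬ Collapses cls (cls y') (toS q) := fun h => hy' (hcol _ h)
    have heq : cls x' = cls y' := by
      rcases lt_trichotomy (cls x') (cls y') with h | h | h
      · exact absurd ⟨y', x', rfl, h, (toS q).symm hq⟩ hyq
      · exact h
      · exact absurd ⟨x', y', rfl, h, hq⟩ hxq
    have := det _ p q hpq hxq (htr _ hxq) x' y' rfl heq.symm hq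
    exact (toS p).trans hxx' ((toS p).trans this ((toS p).symm hyy'))
  · rintro p - ⟨x, y, -, hy, -⟩
    exact absurd hy (not_lt.2 (hk₀ _))
  · refine Finset.sum_le_sum fun k _ => mk_le_height ?_
    rintro _ ⟨p, ⟨hp, -⟩, rfl⟩ _ ⟨q, ⟨hq, -⟩, rfl⟩ _
    exact (hC.total hp hq).imp (fun h => tr_mono k h) fun h => tr_mono k h

/-- Lower bound for the height of a poset `P` of equivalences on a set with finitely many layers:
chains of prescribed traces are realised one layer above the other, by equivalences that collapse
everything below the layer and are trivial above it. -/
theorem sum_le_height_of_layers [Fintype ι] [Nonempty ι] [∀ k, OrderTop (Q k)]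
    (toS : P ↪o Setoid X)
    (cls : X → ι) (cls_surj : Function.Surjective cls) (t : P) (ht : toS t = ⊤)
    (tr : ∀ k, P → Q k)
    (tr_top : ∀ k p, (∀ x y, cls x = k → cls y = k → toS p x y) → tr k p = ⊤)
    (fam : ∀ k, Q k → P) (fam_mono : ∀ k, Monotone (fam k)) (tr_fam : ∀ k N, tr k (fam k N) = N)
    (fam_below : ∀ k N x y, cls x < k → cls y < k → toS (fam k N) x y)
    (fam_above : ∀ k N x y, toS (fam k N) x y → x = y ∨ cls x ≤ k ∧ cls y ≤ k)
    (fam_sep : ∀ k N, ¬ Collapses cls k (toS (fam k N))) :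
    ∑ k, height (Q k) ≤ height P := by
  classical
  obtain ⟨k₀, hk₀⟩ := Finite.exists_min (id : ι → ι)
  refine sum_height_le fun C hC => ?_
  have ht' : ∀ p, p ≤ t := fun p => by
    rw [← toS.le_iff_le, ht]
    exact le_top
  -- The full congruence on the lowest layer reappears as the collapse below the next layer; the
  -- index of this member of the family is used for the universal congruence instead.
  let F : (Σ k, C k) → P := fun z =>
    if z.1 = k₀ ∧ (z.2 : Q z.1) = ⊤ then t else fam z.1 z.2
  have not_full : ∀ k (N : Q k), ¬ (k = k₀ ∧ N = ⊤) →
      ¬ ∀ x y, cls x ≤ k → cls y ≤ k → toS (fam k N) x y := by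
    intro k N hkN hall
    by_cases hk : k = k₀
    · refine hkN ⟨hk, ?_⟩
      rw [← tr_fam k N]
      exact tr_top k _ fun x y hx hy => hall x y hx.le hy.le
    · obtain ⟨x, hx⟩ := cls_surj k
      obtain ⟨y, hy⟩ := cls_surj k₀
      have hlt : k₀ < k := lt_of_le_of_ne (hk₀ k) (Ne.symm hk)
      exact fam_sep k N ⟨x, y, hx, hy ▸ hlt, hall x y hx.le (hy ▸ hlt.le)⟩
  have fam_lt : ∀ k (N : Q k) k' (N' : Q k'), k < k' → fam k N ≤ fam k' N' := by
    intro k N k' N' hkk'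
    rw [← toS.le_iff_le]
    intro x y hxy
    rcases fam_above k N x y hxy with rfl | ⟨hx, hy⟩
    · exact (toS _).refl _
    · exact fam_below k' N' x y (hx.trans_lt hkk') (hy.trans_lt hkk')
  have fam_ne : ∀ k (N : Q k) k' (N' : Q k'), k < k' → ¬ (k = k₀ ∧ N = ⊤) →
      fam k N ≠ fam k' N' := by
    intro k N k' N' hkk' hkN heq
    refine not_full k N hkN fun x y hx hy => ?_
    rw [heq]
    exact fam_below k' N' x y (hx.trans_lt hkk') (hy.trans_lt hkk')
  have hinj : Function.Injective F := by
    have aux : ∀ z : Σ k, C k, ¬ (z.1 = k₀ ∧ (z.2 : Q z.1) = ⊤) → fam z.1 z.2 ≠ t :=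
      fun z hz heq => not_full z.1 z.2 hz fun x y _ _ => by rw [heq, ht]; trivial
    rintro ⟨k, N, hN⟩ ⟨k', N', hN'⟩ h
    simp only [F] at h
    split_ifs at h with h1 h2 h2
    · obtain ⟨rfl, h1⟩ := h1
      obtain ⟨rfl, h2⟩ := h2
      have : N = N' := h1.trans h2.symm
      subst this
      rfl
    · exact absurd h.symm (aux ⟨k', N', hN'⟩ h2)
    · exact absurd h (aux ⟨k, N, hN⟩ h1)
    · rcases lt_trichotomy k k' with hk | rfl | hk
      · exact absurd h (fam_ne k N k' N' hk h1)
      · have : N = N' := by rw [← tr_fam k N, h, tr_fam]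
        subst this
        rfl
      · exact absurd h.symm (fam_ne k' N' k N hk h2)
  have hchain : IsChain (· ≤ ·) (Set.range F) := by
    rintro _ ⟨⟨k, N, hN⟩, rfl⟩ _ ⟨⟨k', N', hN'⟩, rfl⟩ _
    simp only [F]
    split_ifs with h1 h2 h2
    · exact Or.inl le_rfl
    · exact Or.inr (ht' _)
    · exact Or.inl (ht' _)
    · rcases lt_trichotomy k k' with hk | rfl | hk
      · exact Or.inl (fam_lt k N k' N' hk)
      · exact ((hC k).total hN hN').imp (fun h => fam_mono k h) fun h => fam_mono k h
      · exact Or.inr (fam_lt k' N' k N hk)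
  calc ∑ k, #(C k) = #(Σ k, C k) := (mk_sigma_of_fintype _).symm
    _ = #(Set.range F) := (Cardinal.mk_range_eq F hinj).symm
    _ ≤ height P := mk_le_height hchain

end Layers

/-! ### Inverse semigroups and Green's relations -/

/-- The inversion of an inverse semigroup, as a class: `x⁻¹` is the unique inverse of `x`. -/
class InverseSemigroup (S : Type u) [Semigroup S] extends Inv S where
  mul_inv_mul (x : S) : x * x⁻¹ * x = x
  inv_mul_inv (x : S) : x⁻¹ * x * x⁻¹ = x⁻¹
  eq_inv (x y : S) : x * y * x = x → y * x * y = y → y = x⁻¹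

/-- The inversion given by the existence and uniqueness of inverses. -/
@[reducible] noncomputable def IsInverseSemigroup.inverseSemigroup {S : Type u} [Semigroup S]
    (hS : IsInverseSemigroup S) : InverseSemigroup S where
  inv x := (hS x).choose
  mul_inv_mul x := (hS x).choose_spec.1.1
  inv_mul_inv x := (hS x).choose_spec.1.2
  eq_inv x y h k := (hS x).choose_spec.2 y ⟨h, k⟩

section InverseSemigroup

variable {S : Type u} [Semigroup S] [InverseSemigroup S]

open InverseSemigroup

theorem mul_inv_mul' (x : S) : x * (x⁻¹ * x) = x := by rw [← mul_assoc, mul_inv_mul]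

theorem inv_eq_self {e : S} (he : e * e = e) : e⁻¹ = e :=
  (eq_inv e e (by rw [he, he]) (by rw [he, he])).symm

theorem inv_inv' (x : S) : x⁻¹⁻¹ = x := (eq_inv x⁻¹ x (inv_mul_inv x) (mul_inv_mul x)).symm

theorem mul_inv_idem (x : S) : x * x⁻¹ * (x * x⁻¹) = x * x⁻¹ := by
  rw [← mul_assoc, mul_inv_mul]

theorem inv_mul_idem (x : S) : x⁻¹ * x * (x⁻¹ * x) = x⁻¹ * x := by
  rw [← mul_assoc, inv_mul_inv]

/-- The inverse `x` of `e * f` absorbs `f` on the left and `e` on the right, since `f * x * e` is an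
inverse of `e * f` as well; hence `x` is idempotent, and so is its inverse `e * f`. -/
theorem mul_idem {e f : S} (he : e * e = e) (hf : f * f = f) : e * f * (e * f) = e * f := by
  set x := (e * f)⁻¹ with hx
  have h1 : e * f * x * (e * f) = e * f := mul_inv_mul _
  have h2 : x * (e * f) * x = x := inv_mul_inv _
  have h3 : f * x * e = x := by
    refine eq_inv _ _ ?_ ?_
    · grind
    · grind
  have h4 : x * x = x := by grind
  have h5 : e * f = x := by rw [← inv_inv' (e * f), ← hx, inv_eq_self h4]
  rw [h5, h4]

theorem idem_comm {e f : S} (he : e * e = e) (hf : f * f = f) : e * f = f * e := by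
  have h1 := mul_idem he hf
  have h2 := mul_idem hf he
  rw [← inv_eq_self h1]
  exact (eq_inv _ _ (by grind) (by grind)).symm

theorem mul_inv_rev' (x y : S) : (x * y)⁻¹ = y⁻¹ * x⁻¹ := by
  have h := idem_comm (inv_mul_idem x) (mul_inv_idem y)
  have hx := mul_inv_mul x
  have hx' := inv_mul_inv x
  have hy := mul_inv_mul y
  have hy' := inv_mul_inv y
  exact (eq_inv _ _ (by grind) (by grind)).symm

theorem conj_idem {e : S} (he : e * e = e) (x : S) :
    x * e * x⁻¹ * (x * e * x⁻¹) = x * e * x⁻¹ := by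
  have h := idem_comm (inv_mul_idem x) he
  have hx := mul_inv_mul x
  grind

theorem mul_inv_of_inv_mul_eq {z b : S} (h : z⁻¹ * z = b⁻¹ * b) :
    z * b⁻¹ * (z * b⁻¹)⁻¹ = z * z⁻¹ := by
  rw [mul_inv_rev', inv_inv', mul_assoc, ← mul_assoc b⁻¹, ← h, inv_mul_inv]

theorem inv_mul_of_inv_mul_eq {z b : S} (h : z⁻¹ * z = b⁻¹ * b) :
    (z * b⁻¹)⁻¹ * (z * b⁻¹) = b * b⁻¹ := by
  rw [mul_inv_rev', inv_inv', mul_assoc, ← mul_assoc z⁻¹, h, ← mul_assoc, mul_inv_mul']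

theorem leL_iff {x y : S} : leL x y ↔ x * (y⁻¹ * y) = x := by
  constructor
  · rintro ⟨s, hs⟩
    have hy := mul_inv_mul' y
    induction s with
    | one =>
      rw [one_mul, WithOne.coe_inj] at hs
      rw [hs, hy]
    | coe s =>
      rw [← WithOne.coe_mul, WithOne.coe_inj] at hs
      rw [hs, mul_assoc, hy]
  · intro h
    exact ⟨(x * y⁻¹ : S), by rw [← WithOne.coe_mul, mul_assoc, h]⟩

theorem leR_iff {x y : S} : leR x y ↔ y * y⁻¹ * x = x := by
  constructor
  · rintro ⟨s, hs⟩
    have hy := mul_inv_mul y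
    induction s with
    | one =>
      rw [mul_one, WithOne.coe_inj] at hs
      rw [hs, hy]
    | coe s =>
      rw [← WithOne.coe_mul, WithOne.coe_inj] at hs
      rw [hs, ← mul_assoc, hy]
  · intro h
    exact ⟨(y⁻¹ * x : S), by rw [← WithOne.coe_mul, ← mul_assoc, h]⟩

theorem leJ_iff {x y : S} : leJ x y ↔ ∃ s t : S, x = s * y * t := by
  constructor
  · rintro ⟨s, t, h⟩
    have h' : (x : WithOne S) = ((x * x⁻¹ : S) * s) * y * (t * (x⁻¹ * x : S)) := by
      have hx : ((x * x⁻¹ * x * (x⁻¹ * x) : S) : WithOne S) = x := by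
        rw [mul_inv_mul, mul_inv_mul']
      rw [← hx, WithOne.coe_mul, WithOne.coe_mul (x * x⁻¹), h]
      simp only [mul_assoc]
    have hl : ∃ s' : S, ((x * x⁻¹ : S) : WithOne S) * s = s' := by
      induction s with
      | one => exact ⟨_, mul_one _⟩
      | coe s => exact ⟨_, rfl⟩
    have hr : ∃ t' : S, t * ((x⁻¹ * x : S) : WithOne S) = t' := by
      induction t with
      | one => exact ⟨_, one_mul _⟩
      | coe t => exact ⟨_, rfl⟩
    obtain ⟨s', hs'⟩ := hl
    obtain ⟨t', ht'⟩ := hr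
    rw [hs', ht'] at h'
    exact ⟨s', t', by exact_mod_cast h'⟩
  · rintro ⟨s, t, h⟩
    exact ⟨s, t, by exact_mod_cast h⟩

theorem greenL_iff {x y : S} : greenL S x y ↔ x⁻¹ * x = y⁻¹ * y := by
  change leL x y ∧ leL y x ↔ _
  rw [leL_iff, leL_iff]
  constructor
  · rintro ⟨h, k⟩
    have := idem_comm (inv_mul_idem x) (inv_mul_idem y)
    grind
  · intro h
    rw [← h, mul_inv_mul', h, mul_inv_mul']
    exact ⟨rfl, rfl⟩

theorem greenR_iff {x y : S} : greenR S x y ↔ x * x⁻¹ = y * y⁻¹ := by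
  change leR x y ∧ leR y x ↔ _
  rw [leR_iff, leR_iff]
  constructor
  · rintro ⟨h, k⟩
    have := idem_comm (mul_inv_idem x) (mul_inv_idem y)
    grind
  · intro h
    rw [← h, mul_inv_mul, h, mul_inv_mul]
    exact ⟨rfl, rfl⟩

/-- Two elements are `D`-related exactly if some `z` is `L`-related to the first and `R`-related to
the second. -/
theorem greenD_iff {x y : S} : greenD S x y ↔ ∃ z : S, z⁻¹ * z = x⁻¹ * x ∧ z * z⁻¹ = y * y⁻¹ := by
  constructor
  · intro h
    let r : Setoid S :=
      { r := fun x y => ∃ z : S, z⁻¹ * z = x⁻¹ * x ∧ z * z⁻¹ = y * y⁻¹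
        iseqv :=
          { refl := fun x => ⟨x, rfl, rfl⟩
            symm := by
              rintro x y ⟨z, h1, h2⟩
              refine ⟨x * z⁻¹ * y, ?_, ?_⟩
              · rw [mul_inv_rev', mul_inv_rev', inv_inv']
                have := mul_inv_mul z
                have := mul_inv_mul y
                grind
              · rw [mul_inv_rev', mul_inv_rev', inv_inv']
                have := mul_inv_mul z
                have := mul_inv_mul x
                grind
            trans := by
              rintro x y w ⟨z, h1, h2⟩ ⟨v, h3, h4⟩
              refine ⟨v * y⁻¹ * z, ?_, ?_⟩
              · rw [mul_inv_rev', mul_inv_rev', inv_inv']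
                have := mul_inv_mul z
                have := mul_inv_mul y
                grind
              · rw [mul_inv_rev', mul_inv_rev', inv_inv']
                have := mul_inv_mul v
                have := mul_inv_mul y
                grind } }
    have hr : greenD S ≤ r :=
      sup_le (fun x y h => ⟨y, (greenL_iff.1 h).symm, rfl⟩)
        fun x y h => ⟨x, rfl, greenR_iff.1 h⟩
    exact hr h
  · rintro ⟨z, h1, h2⟩
    exact (greenD S).trans
      ((le_sup_left : greenL S ≤ greenD S) (greenL_iff.2 h1.symm))
      ((le_sup_right : greenR S ≤ greenD S) (greenR_iff.2 h2))

/-- A faithful representation of a group `G` as the maximal subgroup of `S` with identity `f`. -/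
structure MaximalSubgroupEquiv (G : Type v) [Group G] (f : S) where
  /-- The element of `S` that represents an element of `G`. -/
  toFun : G → S
  map_mul (g k : G) : toFun (g * k) = toFun g * toFun k
  inj : Function.Injective toFun
  mul_inv (g : G) : toFun g * (toFun g)⁻¹ = f
  inv_mul (g : G) : (toFun g)⁻¹ * toFun g = f
  surj (t : S) : t * t⁻¹ = f → t⁻¹ * t = f → ∃ g, toFun g = t

namespace MaximalSubgroupEquiv

variable {G : Type v} [Group G] {f : S} (φ : MaximalSubgroupEquiv G f)

instance : CoeFun (MaximalSubgroupEquiv G f) fun _ => G → S := ⟨toFun⟩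

theorem map_one : φ 1 = f := by
  have h : φ 1 * φ 1 = φ 1 := by rw [← φ.map_mul, one_mul]
  have h1 := φ.mul_inv 1
  rwa [inv_eq_self h, h] at h1

theorem one_mul' (g : G) : f * φ g = φ g := by
  have h := φ.map_mul 1 g
  rw [one_mul, φ.map_one] at h
  exact h.symm

theorem mul_one' (g : G) : φ g * f = φ g := by
  have h := φ.map_mul g 1
  rw [mul_one, φ.map_one] at h
  exact h.symm

theorem idem {f : S} (φ : MaximalSubgroupEquiv G f) : f * f = f := by
  have h := φ.one_mul' 1
  rwa [φ.map_one] at h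

theorem map_inv_mul (g : G) : φ g⁻¹ * φ g = f := by rw [← φ.map_mul, inv_mul_cancel, φ.map_one]

theorem mul_map_inv (g : G) : φ g * φ g⁻¹ = f := by rw [← φ.map_mul, mul_inv_cancel, φ.map_one]

end MaximalSubgroupEquiv

/-- The Schützenberger group of the `H`-class of `x` is the maximal subgroup with identity
`x * x⁻¹`: a permutation `σ` is the left translation by `σ x * x⁻¹`. -/
def schutzenbergerEquiv (x : S) : MaximalSubgroupEquiv (schutzenbergerGroup x) (x * x⁻¹) := by
  have hx₀ : greenH S x x := (greenH S).refl x
  -- Elements of the `H`-class have the same left and right identities as `x`.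
  have hL : ∀ h : hClass x, (h : S)⁻¹ * h = x⁻¹ * x := fun h => greenL_iff.1 h.2.1
  have hR : ∀ h : hClass x, (h : S) * (h : S)⁻¹ = x * x⁻¹ := fun h => greenR_iff.1 h.2.2
  have key : ∀ (σ : schutzenbergerGroup x) (h : hClass x),
      (σ.1 h : S) = (σ.1 ⟨x, hx₀⟩ : S) * x⁻¹ * h := by
    rintro ⟨σ, t, ht⟩ h
    have h1 : ((σ h : S) : WithOne S) = t * ((x * x⁻¹ * h : S) : WithOne S) := by
      rw [ht h, ← hR h, mul_inv_mul]
    rw [WithOne.coe_mul, WithOne.coe_mul, ← mul_assoc, ← mul_assoc, ← ht ⟨x, hx₀⟩] at h1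
    exact_mod_cast h1
  refine ⟨fun σ => (σ.1 ⟨x, hx₀⟩ : S) * x⁻¹, ?_, ?_, ?_, ?_, ?_⟩
  · intro σ τ
    have := key σ (τ.1 ⟨x, hx₀⟩)
    rw [← mul_assoc, ← this]
    rfl
  · intro σ τ h
    refine Subtype.ext (Equiv.ext fun y => Subtype.ext ?_)
    rw [key σ, key τ]
    exact congrArg (· * (y : S)) h
  · intro σ
    have h1 := hL (σ.1 ⟨x, hx₀⟩)
    have h2 := hR (σ.1 ⟨x, hx₀⟩)
    have h3 := mul_inv_mul (σ.1 ⟨x, hx₀⟩ : S)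
    have h4 := mul_inv_mul x
    rw [mul_inv_rev', inv_inv']
    grind
  · intro σ
    have h1 := hL (σ.1 ⟨x, hx₀⟩)
    have h4 := mul_inv_mul x
    rw [mul_inv_rev', inv_inv']
    grind
  · intro t h1 h2
    have hmem : ∀ u : S, u * u⁻¹ = x * x⁻¹ → u⁻¹ * u = x * x⁻¹ → ∀ h : hClass x,
        u * h ∈ hClass x := by
      intro u h1 h2 h
      have h3 := hL h
      have h4 := hR h
      refine ⟨greenL_iff.2 ?_, greenR_iff.2 ?_⟩
      · rw [mul_inv_rev', mul_assoc, ← mul_assoc u⁻¹, h2, ← h4, mul_inv_mul, h3]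
      · rw [mul_inv_rev', mul_assoc, ← mul_assoc (h : S), h4, ← h2, inv_mul_inv, h1, h2]
    have hcancel : ∀ h : hClass x, x * x⁻¹ * (h : S) = h := fun h => by
      rw [← hR h, mul_inv_mul]
    let σ : Equiv.Perm (hClass x) :=
      { toFun := fun h => ⟨t * h, hmem t h1 h2 h⟩
        invFun := fun h => ⟨t⁻¹ * h, hmem t⁻¹ (by rw [inv_inv', h2]) (by rw [inv_inv', h1]) h⟩
        left_inv := fun h => Subtype.ext (by
          change t⁻¹ * (t * (h : S)) = h
          rw [← mul_assoc, h2, hcancel])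
        right_inv := fun h => Subtype.ext (by
          change t * (t⁻¹ * (h : S)) = h
          rw [← mul_assoc, h1, hcancel]) }
    refine ⟨⟨σ, t, fun h => rfl⟩, ?_⟩
    change t * x * x⁻¹ = t
    rw [mul_assoc, ← h2, mul_inv_mul']

end InverseSemigroup

/-! ### Left congruences -/

section LeftCongruences

open InverseSemigroup

variable {S : Type u} [Semigroup S] [InverseSemigroup S]

/-- The trace of a left congruence at `b`: the subgroup of those elements of the maximal subgroup
with identity `b * b⁻¹` that move `b` within its congruence class. -/
def leftTrace {b : S} {G : Type v} [Group G] (φ : MaximalSubgroupEquiv G (b * b⁻¹))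
    (ρ : LCong S) : Subgroup G where
  carrier := {g | ρ.1 (φ g * b) b}
  one_mem' := by
    change ρ.1 (φ 1 * b) b
    rw [φ.map_one, mul_inv_mul]
  mul_mem' := by
    intro g k hg hk
    change ρ.1 (φ (g * k) * b) b
    rw [φ.map_mul, mul_assoc]
    exact ρ.1.trans (ρ.2 _ _ _ hk) hg
  inv_mem' := by
    intro g hg
    change ρ.1 (φ g⁻¹ * b) b
    have := ρ.2 (φ g⁻¹) _ _ hg
    rw [← mul_assoc, φ.map_inv_mul, mul_inv_mul] at this
    exact ρ.1.symm this

theorem mem_leftTrace {b : S} {G : Type v} [Group G] {φ : MaximalSubgroupEquiv G (b * b⁻¹)}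
    {ρ : LCong S} {g : G} : g ∈ leftTrace φ ρ ↔ ρ.1 (φ g * b) b := Iff.rfl

/-- The subset `N * b` of the `R`-class of `b`, for a subgroup `N`. -/
def leftOrbit {b : S} {G : Type v} [Group G] (φ : MaximalSubgroupEquiv G (b * b⁻¹))
    (N : Subgroup G) : Set S := {x | ∃ g ∈ N, x = φ g * b}

/-- For `b` of rank `k`, the left congruence that collapses the elements of rank below `k`, is trivial
on the elements whose rank is not at most `k`, and relates two elements of rank at most `k` if they cannot be told
apart by left translating them into `N * b`. Only translations by elements of `b * b⁻¹ * S` are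
considered; this makes the congruence monotone in `N`. -/
def leftFam {ι : Type v} [LinearOrder ι] (cls : S → ι) (hcls : ∀ a x, cls (a * x) ≤ cls x)
    {b : S} {G : Type v} [Group G] (φ : MaximalSubgroupEquiv G (b * b⁻¹)) (k : ι)
    (N : Subgroup G) : LCong S where
  val :=
    { r := fun x y => (x = y ∨ cls x ≤ k ∧ cls y ≤ k) ∧
        ∀ s, b * b⁻¹ * s = s → (s * x ∈ leftOrbit φ N ↔ s * y ∈ leftOrbit φ N)
      iseqv :=
        { refl := fun x => ⟨Or.inl rfl, fun _ _ => Iff.rfl⟩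
          symm := fun h => ⟨h.1.imp Eq.symm And.symm, fun s hs => (h.2 s hs).symm⟩
          trans := by
            rintro x y z ⟨h1, h2⟩ ⟨h3, h4⟩
            refine ⟨?_, fun s hs => (h2 s hs).trans (h4 s hs)⟩
            rcases h1 with rfl | h1
            · exact h3
            · rcases h3 with rfl | h3
              · exact Or.inr h1
              · exact Or.inr ⟨h1.1, h3.2⟩ } }
  property := by
    rintro a x y ⟨h1, h2⟩
    refine ⟨h1.imp (fun h => by rw [h]) fun h => ⟨(hcls _ _).trans h.1, (hcls _ _).trans h.2⟩,
      fun s hs => ?_⟩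
    rw [← mul_assoc, ← mul_assoc]
    exact h2 (s * a) (by rw [← mul_assoc, hs])

theorem leftFam_mono {ι : Type v} [LinearOrder ι] (cls : S → ι)
    (hcls : ∀ a x, cls (a * x) ≤ cls x) {b : S} {G : Type v} [Group G]
    (φ : MaximalSubgroupEquiv G (b * b⁻¹)) (k : ι) : Monotone (leftFam cls hcls φ k) := by
  intro N N' hN x y hxy
  refine ⟨hxy.1, ?_⟩
  have aux : ∀ x y : S, leftFam cls hcls φ k N |>.1 x y → ∀ s, b * b⁻¹ * s = s →
      s * x ∈ leftOrbit φ N' → s * y ∈ leftOrbit φ N' := by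
    rintro x y ⟨-, h⟩ s hs ⟨g, hg, hgx⟩
    -- Translating back by `g⁻¹` moves `s * x` to `b`, which lies in `N * b`.
    have h1 := (h (φ g⁻¹ * s) (by rw [← mul_assoc, φ.one_mul'])).1
      ⟨1, one_mem _, by rw [mul_assoc, hgx, ← mul_assoc, φ.map_inv_mul, φ.map_one]⟩
    obtain ⟨g', hg', h2⟩ := h1
    refine ⟨g * g', mul_mem hg (hN hg'), ?_⟩
    rw [φ.map_mul, mul_assoc (φ g), ← h2, ← mul_assoc, ← mul_assoc, φ.mul_map_inv, hs]
  exact fun s hs => ⟨aux x y hxy s hs, aux y x (Setoid.symm' _ hxy) s hs⟩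

theorem leftTrace_leftFam {ι : Type v} [LinearOrder ι] (cls : S → ι)
    (hcls : ∀ a x, cls (a * x) ≤ cls x) {b : S} {G : Type v} [Group G]
    (φ : MaximalSubgroupEquiv G (b * b⁻¹)) {k : ι} (hk : cls b ≤ k) (N : Subgroup G) :
    leftTrace φ (leftFam cls hcls φ k N) = N := by
  ext g
  rw [mem_leftTrace]
  constructor
  · rintro ⟨-, h⟩
    obtain ⟨g', hg', h1⟩ := (h (b * b⁻¹) (mul_inv_idem b)).2
      ⟨1, one_mem _, by rw [φ.map_one]⟩
    have : g = g' := φ.inj <| by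
      have h2 := congrArg (· * b⁻¹) h1
      simp only [mul_assoc] at h2
      rw [φ.mul_one', φ.mul_one', ← mul_assoc, φ.one_mul'] at h2
      exact h2
    rwa [this]
  · intro hg
    refine ⟨Or.inr ⟨(hcls _ _).trans hk, hk⟩, fun s hs => ?_⟩
    have cancel : ∀ g g' : G, s * (φ g * b) = φ g' * b → s * b = φ (g' * g⁻¹) * b := by
      intro g g' h
      -- Cancel `b` on the right, and then `g`.
      have h2 := congrArg (· * b⁻¹) h
      simp only [mul_assoc] at h2
      rw [φ.mul_one', φ.mul_one'] at h2
      rw [φ.map_mul, ← h2, mul_assoc s, φ.mul_map_inv, mul_assoc, mul_inv_mul]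
    constructor
    · rintro ⟨g', hg', h⟩
      exact ⟨g' * g⁻¹, mul_mem hg' (inv_mem hg), cancel g g' h⟩
    · rintro ⟨g', hg', h⟩
      refine ⟨g' * g, mul_mem hg' hg, ?_⟩
      have h2 := congrArg (· * b⁻¹) h
      simp only [mul_assoc] at h2
      rw [φ.mul_one'] at h2
      rw [φ.map_mul, ← h2, ← mul_assoc, mul_assoc s, mul_assoc s, φ.one_mul', mul_assoc]

/-- If there are only finitely many idempotents, then an element of `f * S` whose right identity is
`f` lies in the maximal subgroup with identity `f`. -/
theorem mul_inv_eq_of_le [Finite (idempotents S)] {w f : S} (hw : w⁻¹ * w = f)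
    (hle : f * w = w) : w * w⁻¹ = f := by
  have hf : f * f = f := by rw [← hw, inv_mul_idem]
  let A : Set S := {g | g * g = g ∧ f * g = g}
  have hA : A.Finite := (Set.toFinite (idempotents S)).subset fun g hg => hg.1
  have : Finite A := hA
  -- Conjugation by `w` is an injective self-map of the finite set of idempotents below `f`.
  let T : A → A := fun g => ⟨w * g * w⁻¹, conj_idem g.2.1 w, by rw [← mul_assoc, ← mul_assoc, hle]⟩
  have hT : Function.Injective T := by
    rintro ⟨g, hg, hfg⟩ ⟨k, hk, hfk⟩ h
    have h1 : w * g * w⁻¹ = w * k * w⁻¹ := congrArg Subtype.val h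
    have h2 : w⁻¹ * (w * g * w⁻¹) * w = w⁻¹ * (w * k * w⁻¹) * w := by rw [h1]
    have h3 := idem_comm hf hg
    have h4 := idem_comm hf hk
    refine Subtype.ext ?_
    change g = k
    grind
  obtain ⟨⟨g, hg, hfg⟩, h⟩ := Finite.surjective_of_injective hT ⟨f, hf, hf⟩
  have h1 : w * g * w⁻¹ = f := congrArg Subtype.val h
  have h2 : w * w⁻¹ * f = f := by
    rw [← h1, ← mul_assoc, ← mul_assoc, mul_inv_mul]
  rw [← h2, idem_comm (mul_inv_idem w) hf, ← mul_assoc, hle]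

/-- On an uncollapsed `L`-class, a left congruence `σ` relates `x` and `y` only if
`b * x⁻¹ * y = t * b` with `t` in the maximal subgroup at `b`; this moves the pair to the trace. -/
theorem leftTrace_determines [Finite (idempotents S)] {ι : Type v} [LinearOrder ι] (cls : S → ι)
    (hcls : ∀ a x, cls (a * x) ≤ cls x) (hL : ∀ x y, cls x = cls y ↔ x⁻¹ * x = y⁻¹ * y)
    {b : S} {G : Type v} [Group G] (φ : MaximalSubgroupEquiv G (b * b⁻¹)) {ρ σ : LCong S}
    (hcol : ¬ Collapses cls (cls b) σ.1) (htr : leftTrace φ ρ = leftTrace φ σ) {x y : S}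
    (hx : cls x = cls b) (hy : cls y = cls b) (hxy : σ.1 x y) : ρ.1 x y := by
  have aux : ∀ x y : S, cls x = cls b → cls y = cls b → σ.1 x y →
      ρ.1 (x * x⁻¹ * y) x ∧ y * y⁻¹ * x = x := by
    intro x y hx hy hxy
    rw [hL] at hx hy
    have h1 : σ.1 b (b * x⁻¹ * y) := by
      have := σ.2 (b * x⁻¹) _ _ hxy
      rwa [mul_assoc b, hx, mul_inv_mul'] at this
    set z := b * x⁻¹ * y with hz
    have hzc : cls z = cls b := by
      refine le_antisymm ((hcls _ _).trans_eq ((hL _ _).2 hy)) (not_lt.1 fun hlt => ?_)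
      exact hcol ⟨b, z, rfl, hlt, h1⟩
    rw [hL] at hzc
    have hzz : z * z⁻¹ = b * b⁻¹ := by
      have hfz : b * b⁻¹ * z = z := by rw [hz, ← mul_assoc, ← mul_assoc, mul_inv_mul]
      rw [← mul_inv_of_inv_mul_eq hzc]
      exact mul_inv_eq_of_le (inv_mul_of_inv_mul_eq hzc) (by rw [← mul_assoc, hfz])
    obtain ⟨g, hg⟩ := φ.surj (z * b⁻¹)
      ((mul_inv_of_inv_mul_eq hzc).trans hzz) (inv_mul_of_inv_mul_eq hzc)
    have hgb : φ g * b = z := by rw [hg, mul_assoc, ← hzc, mul_inv_mul']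
    have hgσ : g ∈ leftTrace φ σ := by
      rw [mem_leftTrace, hgb]
      exact σ.1.symm h1
    rw [← htr, mem_leftTrace, hgb] at hgσ
    have hxb : x * b⁻¹ * b = x := by rw [mul_assoc, ← hx, mul_inv_mul']
    constructor
    · have := ρ.2 (x * b⁻¹) _ _ hgσ
      rwa [hxb, hz, ← mul_assoc, ← mul_assoc, hxb] at this
    · -- `z * z⁻¹ = b * b⁻¹` says that `x * x⁻¹ ≤ y * y⁻¹`.
      have h2 : x * b⁻¹ * (z * z⁻¹) * b = x := by rw [hzz, mul_assoc, mul_inv_mul, hxb]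
      have h3 : z * z⁻¹ = b * (x⁻¹ * (y * y⁻¹) * x) * b⁻¹ := by
        rw [hz, mul_inv_rev', mul_inv_rev', inv_inv']
        simp only [mul_assoc]
      have h4 := idem_comm (mul_inv_idem x) (mul_inv_idem y)
      have h5 := mul_inv_mul x
      rw [h3] at h2
      simp only [← mul_assoc] at h2
      rw [hxb, mul_assoc _ b⁻¹ b, mul_assoc _ x, ← mul_assoc x b⁻¹, hxb] at h2
      calc y * y⁻¹ * x = y * y⁻¹ * (x * x⁻¹) * x := by rw [mul_assoc _ (x * x⁻¹), h5]
        _ = x := by rw [← h4, ← mul_assoc, h2]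
  have h1 := aux x y hx hy hxy
  have h2 := aux y x hy hx (σ.1.symm hxy)
  have h3 := h2.1
  rw [h1.2] at h3
  exact h3

/-- The height of the lattice of left congruences as a sum over the `L`-classes, indexed by their
idempotents `e`; the base point `b e` of the `L`-class of `e` may be chosen arbitrarily. -/
theorem height_LCong [Nonempty S] [Fintype (idempotents S)] (b : idempotents S → S)
    (hb : ∀ e, (b e)⁻¹ * b e = e) (G : idempotents S → Type u) [∀ e, Group (G e)]
    (φ : ∀ e, MaximalSubgroupEquiv (G e) (b e * (b e)⁻¹)) :
    height (LCong S) = ∑ e, height (Subgroup (G e)) := by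
  have idem : ∀ e : idempotents S, (e : S) * e = e := fun e => e.2
  let r : idempotents S → idempotents S → Prop := fun e f => (e : S) * f = e
  have hr : IsPartialOrder (idempotents S) r :=
    { refl := idem
      trans := fun e f g h k => by
        change (e : S) * g = e
        rw [← show (e : S) * f = e from h, mul_assoc, show (f : S) * g = f from k]
      antisymm := fun e f h k => Subtype.ext <| by
        rw [← show (e : S) * f = e from h, idem_comm (idem e) (idem f)]
        exact k }
  obtain ⟨l, hl⟩ := exists_linearOrder_extending r
  let cls : S → idempotents S := fun x => ⟨x⁻¹ * x, inv_mul_idem x⟩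
  have hL : ∀ x y, cls x = cls y ↔ x⁻¹ * x = y⁻¹ * y := fun x y => Subtype.ext_iff
  have hcls : ∀ a x, cls (a * x) ≤ cls x := fun a x => hl _ _ <| by
    change (a * x)⁻¹ * (a * x) * (x⁻¹ * x) = (a * x)⁻¹ * (a * x)
    rw [mul_assoc, mul_assoc a, mul_inv_mul']
  have hclsb : ∀ e, cls (b e) = e := fun e => Subtype.ext (hb e)
  have : Nonempty (idempotents S) := ‹Nonempty S›.map cls
  apply le_antisymm
  · refine height_le_sum_of_layers (OrderEmbedding.subtype _) cls (fun e => leftTrace (φ e)) ?_ ?_ ?_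
    · exact fun e ρ σ h g hg => h hg
    · intro ρ x x' y hxx' hlt hxy
      refine ⟨x' * x⁻¹ * y, ((hcls _ _).trans_lt hlt).trans_eq hxx', ?_⟩
      have := ρ.2 (x' * x⁻¹) _ _ hxy
      rwa [mul_assoc x', (hL _ _).1 hxx', mul_inv_mul'] at this
    · intro e ρ σ _ hcol htr x y hx hy hxy
      rw [← hclsb e] at hcol hx hy
      exact leftTrace_determines cls hcls hL (φ e) hcol htr hx hy hxy
  · have horb : ∀ e N x, x ∈ leftOrbit (φ e) N → cls x = e := by
      rintro e N _ ⟨g, -, rfl⟩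
      refine ((hL _ _).2 ?_).trans (hclsb e)
      rw [mul_inv_rev', mul_assoc, ← mul_assoc _ _ (b e), (φ e).inv_mul,
        mul_inv_mul]
    refine sum_le_height_of_layers (OrderEmbedding.subtype _) cls
      (fun e => ⟨e, by rw [← hclsb e, hL, hclsb, inv_eq_self (idem e), idem e, hb]⟩)
      ⟨⊤, fun _ _ _ _ => trivial⟩ rfl (fun e => leftTrace (φ e)) ?_
      (fun e => leftFam cls hcls (φ e) e) (fun e => leftFam_mono cls hcls (φ e) e) ?_ ?_ ?_ ?_
    · intro e ρ h
      rw [eq_top_iff]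
      intro g _
      exact h _ _ (horb e ⊤ _ ⟨g, trivial, rfl⟩) (hclsb e)
    · exact fun e N => leftTrace_leftFam cls hcls (φ e) (hclsb e).le N
    · intro e N x y hx hy
      have hlow : ∀ s x, cls x < e → s * x ∉ leftOrbit (φ e) N := fun s x hx h =>
        (horb e N _ h ▸ hcls s x).not_gt hx
      exact ⟨Or.inr ⟨hx.le, hy.le⟩, fun s _ => iff_of_false (hlow s x hx) (hlow s y hy)⟩
    · exact fun e N x y h => h.1
    · rintro e N ⟨x, y, hx, hy, -, h⟩
      rw [← hclsb e, hL] at hx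
      have h1 := (h (b e * x⁻¹) (by rw [← mul_assoc, mul_inv_mul])).1
        ⟨1, one_mem _, by rw [(φ e).map_one, mul_assoc, hx, mul_inv_mul', mul_inv_mul]⟩
      exact (horb e N _ h1 ▸ hcls _ y).not_gt hy

end LeftCongruences

/-! ### Two-sided congruences -/

section Congruences

open InverseSemigroup

theorem greenJ_of_greenD {S : Type u} [Semigroup S] {x y : S} (h : greenD S x y) :
    greenJ S x y := by
  have hL : ∀ {x y : S}, leL x y → leJ x y := fun ⟨s, h⟩ => ⟨s, 1, by rw [mul_one, h]⟩
  have hR : ∀ {x y : S}, leR x y → leJ x y := fun ⟨s, h⟩ => ⟨1, s, by rw [one_mul, h]⟩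
  have : greenD S ≤ greenJ S :=
    sup_le (fun x y h => ⟨hL h.1, hL h.2⟩) fun x y h => ⟨hR h.1, hR h.2⟩
  exact this h

variable {S : Type u} [Semigroup S] [InverseSemigroup S]

theorem leJ_mul_mul (s x t : S) : leJ (s * x * t) x := leJ_iff.2 ⟨s, t, rfl⟩

theorem leJ_mul_left (s x : S) : leJ (s * x) x :=
  leJ_iff.2 ⟨s, x⁻¹ * x, by rw [mul_assoc, mul_inv_mul']⟩

theorem leJ_mul_right (x t : S) : leJ (x * t) x :=
  leJ_iff.2 ⟨x * x⁻¹, t, by rw [mul_inv_mul]⟩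

theorem greenD_of_greenJ (hst : IsStable S) {x y : S} (h : greenJ S x y) : greenD S x y := by
  obtain ⟨s, t, rfl⟩ := leJ_iff.1 h.2
  have h1 : greenJ S x (s * x) := ⟨leJ_trans h.1 (leJ_mul_right _ _), leJ_mul_left _ _⟩
  have h2 : greenJ S (s * x) (s * x * t) := ⟨leJ_trans h1.2 h.1, leJ_mul_right _ _⟩
  exact (greenD S).trans ((le_sup_left : greenL S ≤ greenD S) (hst.1 _ _ h1))
    ((le_sup_right : greenR S ≤ greenD S) (hst.2 _ _ h2))

/-- The trace of a congruence at a maximal subgroup: the normal subgroup of the elements that are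
congruent to the identity. -/
def conTrace {f : S} {G : Type v} [Group G] (φ : MaximalSubgroupEquiv G f) (ρ : Con S) :
    NSub G where
  val :=
    { carrier := {g | ρ (φ g) f}
      one_mem' := by
        change ρ (φ 1) f
        rw [φ.map_one]
        exact ρ.refl f
      mul_mem' := by
        intro g k hg hk
        change ρ (φ (g * k)) f
        rw [φ.map_mul]
        have := ρ.mul hg hk
        rwa [φ.idem] at this
      inv_mem' := by
        intro g hg
        change ρ (φ g⁻¹) f
        have := ρ.mul (ρ.refl (φ g⁻¹)) hg
        rw [φ.map_inv_mul, φ.mul_one'] at this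
        exact ρ.symm this }
  property := ⟨fun g hg k => by
    change ρ (φ (k * g * k⁻¹)) f
    have := ρ.mul (ρ.mul (ρ.refl (φ k)) hg) (ρ.refl (φ k⁻¹))
    rwa [φ.mul_one', φ.mul_map_inv, ← φ.map_mul, ← φ.map_mul] at this⟩

theorem mem_conTrace {f : S} {G : Type v} [Group G] {φ : MaximalSubgroupEquiv G f} {ρ : Con S}
    {g : G} : g ∈ (conTrace φ ρ).1 ↔ ρ (φ g) f := Iff.rfl

/-- For `f` of rank `k`, the congruence that collapses the elements of rank below `k`, is trivial on
the elements whose rank is not at most `k`, and relates two elements of rank at most `k` if they cannot be told apart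
by translating them on both sides into the copy of `N` in `S`. Only translations by elements of
`f * S` and `S * f` are considered; this makes the congruence monotone in `N`. -/
def conFam {ι : Type v} [LinearOrder ι] (cls : S → ι) (hcls : ∀ x y : S, leJ x y → cls x ≤ cls y)
    {f : S} {G : Type v} [Group G] (φ : MaximalSubgroupEquiv G f) (k : ι) (N : NSub G) :
    Con S where
  r x y := (x = y ∨ cls x ≤ k ∧ cls y ≤ k) ∧
    ∀ s t, f * s = s → t * f = t → (s * x * t ∈ φ '' N.1 ↔ s * y * t ∈ φ '' N.1)
  iseqv :=
    { refl := fun x => ⟨Or.inl rfl, fun _ _ _ _ => Iff.rfl⟩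
      symm := fun h => ⟨h.1.imp Eq.symm And.symm, fun s t hs ht => (h.2 s t hs ht).symm⟩
      trans := by
        rintro x y z ⟨h1, h2⟩ ⟨h3, h4⟩
        refine ⟨?_, fun s t hs ht => (h2 s t hs ht).trans (h4 s t hs ht)⟩
        rcases h1 with rfl | h1
        · exact h3
        · rcases h3 with rfl | h3
          · exact Or.inr h1
          · exact Or.inr ⟨h1.1, h3.2⟩ }
  mul' := by
    rintro w x y z ⟨h1, h2⟩ ⟨h3, h4⟩
    constructor
    · rcases h1 with rfl | h1
      · rcases h3 with rfl | h3
        · exact Or.inl rfl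
        · exact Or.inr ⟨(hcls _ _ (leJ_mul_left _ _)).trans h3.1,
            (hcls _ _ (leJ_mul_left _ _)).trans h3.2⟩
      · exact Or.inr ⟨(hcls _ _ (leJ_mul_right _ _)).trans h1.1,
          (hcls _ _ (leJ_mul_right _ _)).trans h1.2⟩
    · intro s t hs ht
      have h5 := h2 s (y * t) hs (by rw [mul_assoc, ht])
      have h6 := h4 (s * x) t (by rw [← mul_assoc, hs]) ht
      simp only [mul_assoc] at h5 h6 ⊢
      exact h5.trans h6

theorem conFam_mono {ι : Type v} [LinearOrder ι] (cls : S → ι)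
    (hcls : ∀ x y : S, leJ x y → cls x ≤ cls y) {f : S} {G : Type v} [Group G]
    (φ : MaximalSubgroupEquiv G f) (k : ι) : Monotone (conFam cls hcls φ k) := by
  intro N N' hN x y hxy
  refine ⟨hxy.1, ?_⟩
  have aux : ∀ x y : S, conFam cls hcls φ k N x y → ∀ s t, f * s = s → t * f = t →
      s * x * t ∈ φ '' N'.1 → s * y * t ∈ φ '' N'.1 := by
    rintro x y ⟨-, h⟩ s t hs ht ⟨g, hg, hgx⟩
    -- Translating back by `g⁻¹` moves `s * x * t` to the identity, which lies in `N`.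
    have h1 := (h (φ g⁻¹ * s) t (by rw [← mul_assoc, φ.one_mul']) ht).1
      ⟨1, one_mem _, by
        rw [mul_assoc (φ g⁻¹), mul_assoc (φ g⁻¹), ← hgx, φ.map_inv_mul, φ.map_one]⟩
    obtain ⟨g', hg', h2⟩ := h1
    refine ⟨g * g', mul_mem hg (hN hg'), ?_⟩
    rw [φ.map_mul, h2, ← mul_assoc, ← mul_assoc, ← mul_assoc, φ.mul_map_inv, hs]
  exact fun s t hs ht => ⟨aux x y hxy s t hs ht, aux y x (Con.symm _ hxy) s t hs ht⟩

/-- By stability, left translations that do not leave the `D`-class of a maximal subgroup act on it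
as multiplication by elements of the group. -/
theorem mul_mem_of_stable (hst : IsStable S) {f : S} {G : Type v} [Group G]
    (φ : MaximalSubgroupEquiv G f) {s u : S} (hs : f * s = s) {g : G} (h : s * f * u = φ g) :
    ∃ k, φ k = s * f := by
  have hf := φ.idem
  have h1 : s * f * (u * φ g⁻¹) = f := by rw [← mul_assoc, h, φ.mul_map_inv]
  have hJ : greenJ S f (s * f) :=
    ⟨by nth_rewrite 1 [← h1]; exact leJ_mul_right _ _, leJ_mul_left _ _⟩
  have hL := greenL_iff.1 (hst.1 _ _ hJ)
  have hR : greenR S f (s * f) := by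
    refine ⟨leR_iff.2 ?_, leR_iff.2 ?_⟩
    · nth_rewrite 3 [← h1]
      rw [← mul_assoc, mul_inv_mul, h1]
    · rw [inv_eq_self hf, hf, ← mul_assoc, hs]
  have hR' := greenR_iff.1 hR
  rw [inv_eq_self hf, hf] at hL hR'
  exact φ.surj _ hR'.symm hL.symm

theorem conTrace_conFam (hst : IsStable S) {ι : Type v} [LinearOrder ι] (cls : S → ι)
    (hcls : ∀ x y : S, leJ x y → cls x ≤ cls y) {f : S} {G : Type v} [Group G]
    (φ : MaximalSubgroupEquiv G f) {k : ι} (hk : cls f ≤ k) (N : NSub G) :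
    conTrace φ (conFam cls hcls φ k N) = N := by
  have hf := φ.idem
  apply Subtype.ext
  ext g
  rw [mem_conTrace]
  constructor
  · rintro ⟨-, h⟩
    obtain ⟨g', hg', h1⟩ := (h f f hf hf).2 ⟨1, one_mem _, by rw [φ.map_one, hf, hf]⟩
    rw [φ.one_mul', φ.mul_one'] at h1
    rwa [← φ.inj h1]
  · intro hg
    refine ⟨Or.inr ⟨?_, hk⟩, fun s t hs _ => ?_⟩
    · rw [← φ.one_mul']
      exact (hcls _ _ (leJ_mul_right _ _)).trans hk
    have move : ∀ g₁ g₂ : G, g₂ * g₁⁻¹ ∈ N.1 →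
        s * φ g₁ * t ∈ φ '' N.1 → s * φ g₂ * t ∈ φ '' N.1 := by
      rintro g₁ g₂ h12 ⟨g', hg', h⟩
      have h1 : s * φ g₁ * t = s * f * (φ g₁ * t) := by
        rw [mul_assoc s f, ← mul_assoc f, φ.one_mul', mul_assoc]
      obtain ⟨k, hk⟩ := mul_mem_of_stable hst φ hs (h1.symm.trans h.symm)
      have h2 : φ k * φ g₁ * t = φ g' := by
        rw [hk, mul_assoc s, φ.one_mul', h]
      -- Normality puts `k * (g₂ * g₁⁻¹) * k⁻¹` into `N`.
      refine ⟨k * (g₂ * g₁⁻¹) * k⁻¹ * g', mul_mem (N.2.conj_mem _ h12 k) hg', ?_⟩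
      have h3 : k * (g₂ * g₁⁻¹) * k⁻¹ * (k * g₁) = k * g₂ := by group
      rw [φ.map_mul, ← h2, ← φ.map_mul k g₁, ← mul_assoc, ← φ.map_mul, h3, φ.map_mul, hk,
        mul_assoc s, φ.one_mul']
    have hm1 := move g 1 (by simpa using hg)
    have hm2 := move 1 g (by simpa using hg)
    rw [φ.map_one] at hm1 hm2
    exact ⟨hm1, hm2⟩

/-- On an uncollapsed `D`-class, a congruence only relates elements of the same `H`-class, and a
pair of related elements can be translated into the maximal subgroup and back. -/
theorem conTrace_determines (hst : IsStable S) {ι : Type v} [LinearOrder ι] (cls : S → ι)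
    (hcls : ∀ x y : S, leJ x y → cls x ≤ cls y) (hD : ∀ x y, cls x = cls y ↔ greenD S x y)
    {f : S} {G : Type v} [Group G] (φ : MaximalSubgroupEquiv G f) {ρ σ : Con S}
    (hcol : ¬ Collapses cls (cls f) σ.toSetoid) (htr : conTrace φ ρ = conTrace φ σ) {x y : S}
    (hx : cls x = cls f) (hy : cls y = cls f) (hxy : σ x y) : ρ x y := by
  have hf := φ.idem
  have stay : ∀ u v : S, cls u = cls f → cls v ≤ cls f → σ u v → cls v = cls f :=
    fun u v hu hv h => hv.antisymm (not_lt.1 fun hlt => hcol ⟨u, v, hu, hlt, h⟩)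
  have auxR : ∀ x y : S, cls x = cls f → cls y = cls f → σ x y → leR y x := by
    intro x y hx hy hxy
    have h1 : cls (x⁻¹ * x) = cls f := by
      rw [← hx, hD]
      refine (le_sup_left : greenL S ≤ greenD S) (greenL_iff.2 ?_)
      rw [inv_eq_self (inv_mul_idem x), inv_mul_idem]
    have h2 := stay _ _ h1 ((hcls _ _ (leJ_mul_left x⁻¹ y)).trans_eq hy)
      (σ.mul (σ.refl _) hxy)
    have h3 : greenJ S y (x⁻¹ * y) := greenJ_of_greenD ((hD _ _).1 (hy.trans h2.symm))
    have h4 := greenL_iff.1 (hst.1 _ _ h3)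
    rw [mul_inv_rev', inv_inv'] at h4
    have h5 := idem_comm (mul_inv_idem x) (mul_inv_idem y)
    have h6 := mul_inv_mul y
    rw [leR_iff]
    grind
  have auxL : ∀ x y : S, cls x = cls f → cls y = cls f → σ x y → leL y x := by
    intro x y hx hy hxy
    have h1 : cls (x * x⁻¹) = cls f := by
      rw [← hx, hD]
      refine (le_sup_right : greenR S ≤ greenD S) (greenR_iff.2 ?_)
      rw [inv_eq_self (mul_inv_idem x), mul_inv_idem]
    have h2 := stay _ _ h1 ((hcls _ _ (leJ_mul_right y x⁻¹)).trans_eq hy)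
      (σ.mul hxy (σ.refl _))
    have h3 : greenJ S y (y * x⁻¹) := greenJ_of_greenD ((hD _ _).1 (hy.trans h2.symm))
    have h4 := greenR_iff.1 (hst.2 _ _ h3)
    rw [mul_inv_rev', inv_inv'] at h4
    have h5 := idem_comm (inv_mul_idem x) (inv_mul_idem y)
    have h6 := mul_inv_mul y
    rw [leL_iff]
    grind
  have hR := greenR_iff.1 ⟨auxR y x hy hx (σ.symm hxy), auxR x y hx hy hxy⟩
  have hL := greenL_iff.1 ⟨auxL y x hy hx (σ.symm hxy), auxL x y hx hy hxy⟩
  obtain ⟨z, hz1, hz2⟩ := greenD_iff.1 ((hD _ _).1 hx)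
  rw [inv_eq_self hf, hf] at hz2
  -- Translation by `z * x⁻¹` and `z⁻¹` moves `x` to `f`, and `y` to an element `v` of the group.
  have hxf : z * x⁻¹ * x * z⁻¹ = f := by
    rw [mul_assoc z, ← hz1, mul_inv_mul', hz2]
  have hw1 : x⁻¹ * y * (x⁻¹ * y)⁻¹ = x⁻¹ * x := by
    rw [mul_inv_rev', inv_inv', mul_assoc, ← mul_assoc y, ← hR, mul_inv_mul]
  have hw2 : (x⁻¹ * y)⁻¹ * (x⁻¹ * y) = x⁻¹ * x := by
    rw [mul_inv_rev', inv_inv', mul_assoc, ← mul_assoc x, hR, mul_inv_mul, hL]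
  set w := x⁻¹ * y with hw
  have hv1 : z * w * z⁻¹ * (z * w * z⁻¹)⁻¹ = f := by
    rw [mul_inv_of_inv_mul_eq, mul_inv_rev', mul_assoc, ← mul_assoc w, hw1, ← hz1, inv_mul_inv,
      hz2]
    rw [mul_inv_rev', mul_assoc, ← mul_assoc z⁻¹, hz1, ← hw1, mul_inv_mul, hw2, hw1]
  have hv2 : (z * w * z⁻¹)⁻¹ * (z * w * z⁻¹) = f := by
    rw [inv_mul_of_inv_mul_eq, hz2]
    rw [mul_inv_rev', mul_assoc, ← mul_assoc z⁻¹, hz1, ← hw1, mul_inv_mul, hw2, hw1]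
  obtain ⟨g, hg⟩ := φ.surj _ hv1 hv2
  have hgσ : g ∈ (conTrace φ σ).1 := by
    rw [mem_conTrace, hg]
    have := σ.mul (σ.mul (σ.refl (z * x⁻¹)) hxy) (σ.refl z⁻¹)
    rw [hxf, mul_assoc z, ← hw] at this
    exact σ.symm this
  rw [← htr, mem_conTrace, hg] at hgσ
  have := ρ.mul (ρ.mul (ρ.refl (x * z⁻¹)) hgσ) (ρ.refl z)
  have hy1 : x * z⁻¹ * (z * w * z⁻¹) * z = y := by
    have h1 : x * z⁻¹ * (z * w * z⁻¹) * z = x * (z⁻¹ * z) * w * (z⁻¹ * z) := by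
      simp only [mul_assoc]
    rw [h1, hz1, mul_inv_mul', hw, ← mul_assoc x, hR, mul_inv_mul, hL, mul_inv_mul']
  have hx1 : x * z⁻¹ * f * z = x := by
    rw [← hz2, mul_assoc, mul_inv_mul, mul_assoc, hz1, mul_inv_mul']
  rw [hy1, hx1] at this
  exact ρ.symm this

instance {G : Type u} [Group G] : OrderTop (NSub G) where
  top := ⟨⊤, inferInstance⟩
  le_top N := (le_top : N.1 ≤ ⊤)

/-- The height of the lattice of congruences of a stable inverse semigroup as a sum over the
`D`-classes. -/
theorem height_Con [Nonempty S] [Fintype (DClass S)] (hst : IsStable S) (f : DClass S → S)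
    (hf : ∀ r, (Quotient.mk (greenD S) (f r) : DClass S) = r) (G : DClass S → Type u)
    [∀ r, Group (G r)] (φ : ∀ r, MaximalSubgroupEquiv (G r) (f r)) :
    height (Con S) = ∑ r, height (NSub (G r)) := by
  let le : DClass S → DClass S → Prop := fun r r' => leJ r.out r'.out
  have hle : IsPartialOrder (DClass S) le :=
    { refl := fun r => leJ_refl _
      trans := fun _ _ _ h k => leJ_trans h k
      antisymm := fun r r' h k => by
        rw [← r.out_eq, ← r'.out_eq]
        exact Quotient.sound (greenD_of_greenJ hst ⟨h, k⟩) }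
  obtain ⟨l, hl⟩ := exists_linearOrder_extending le
  let cls : S → DClass S := Quotient.mk (greenD S)
  have hD : ∀ x y, cls x = cls y ↔ greenD S x y := fun x y => Quotient.eq
  have hJ : ∀ x y, cls x = cls y → greenJ S x y := fun x y h => greenJ_of_greenD ((hD _ _).1 h)
  have hcls : ∀ x y : S, leJ x y → cls x ≤ cls y := fun x y h => hl _ _ <|
    leJ_trans (hJ _ _ (cls x).out_eq).1 (leJ_trans h (hJ _ _ (cls y).out_eq).2)
  have hclsf : ∀ r, cls (f r) = r := hf
  have : Nonempty (DClass S) := ‹Nonempty S›.map cls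
  let toS : Con S ↪o Setoid S :=
    { toFun := fun ρ => ρ.toSetoid
      inj' := fun ρ σ h => Con.toSetoid_injective h
      map_rel_iff' := Iff.rfl }
  apply le_antisymm
  · refine height_le_sum_of_layers toS cls (fun r => conTrace (φ r)) ?_ ?_ ?_
    · exact fun r ρ σ h g hg => h hg
    · intro ρ x x' y hxx' hlt hxy
      obtain ⟨s, t, hst'⟩ := leJ_iff.1 (hJ _ _ hxx').2
      refine ⟨s * y * t, ((hcls _ _ (leJ_mul_mul s y t)).trans_lt hlt).trans_eq hxx', ?_⟩
      rw [hst']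
      exact ρ.mul (ρ.mul (ρ.refl s) hxy) (ρ.refl t)
    · intro r ρ σ _ hcol htr x y hx hy hxy
      rw [← hclsf r] at hcol hx hy
      exact conTrace_determines hst cls hcls hD (φ r) hcol htr hx hy hxy
  · have horb : ∀ r g, cls (φ r g) = r := fun r g =>
      ((hD _ _).2 ((le_sup_right : greenR S ≤ greenD S) (greenR_iff.2 (by
        rw [(φ r).mul_inv, inv_eq_self (φ r).idem, (φ r).idem])))).trans (hclsf r)
    refine sum_le_height_of_layers toS cls (fun r => ⟨f r, hclsf r⟩) ⊤ rfl
      (fun r => conTrace (φ r)) ?_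
      (fun r => conFam cls hcls (φ r) r) (fun r => conFam_mono cls hcls (φ r) r)
      (fun r N => conTrace_conFam hst cls hcls (φ r) (hclsf r).le N) ?_ ?_ ?_
    · intro r ρ h
      rw [eq_top_iff]
      intro g _
      exact h _ _ (horb r g) (hclsf r)
    · intro r N x y hx hy
      have hlow : ∀ s x t, cls x < r → s * x * t ∉ φ r '' N.1 := by
        rintro s x t hx ⟨g, -, hg⟩
        exact (horb r g ▸ hg ▸ hcls _ _ (leJ_mul_mul s x t)).not_gt hx
      exact ⟨Or.inr ⟨hx.le, hy.le⟩,
        fun s t _ _ => iff_of_false (hlow s x t hx) (hlow s y t hy)⟩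
    · exact fun r N x y h => h.1
    · rintro r N ⟨x, y, hx, hy, -, h⟩
      obtain ⟨z, hz1, hz2⟩ := greenD_iff.1 ((hD _ _).1 (hx.trans (hclsf r).symm))
      rw [inv_eq_self (φ r).idem, (φ r).idem] at hz2
      obtain ⟨g, -, hg⟩ := (h (z * x⁻¹) z⁻¹ (by rw [← hz2, ← mul_assoc, mul_inv_mul])
        (by rw [← hz2, ← mul_assoc, inv_mul_inv])).1
        ⟨1, one_mem _, by rw [(φ r).map_one, mul_assoc z, ← hz1, mul_inv_mul', hz2]⟩
      exact (horb r g ▸ hg ▸ hcls _ _ (leJ_mul_mul (z * x⁻¹) y z⁻¹)).not_gt hy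

end Congruences

/-! ### Reduction of the formulas to the sums over classes -/

section Assembly

variable {S : Type u} [Semigroup S]

/-- Inversion turns right congruences of an inverse semigroup into left congruences. -/
def rCongOrderIso [InverseSemigroup S] : RCong S ≃o LCong S where
  toFun ρ := ⟨ρ.1.comap Inv.inv, fun a x y h => by
    change ρ.1 (a * x)⁻¹ (a * y)⁻¹
    rw [mul_inv_rev', mul_inv_rev']
    exact ρ.2 a⁻¹ _ _ h⟩
  invFun ρ := ⟨ρ.1.comap Inv.inv, fun a x y h => by
    change ρ.1 (x * a)⁻¹ (y * a)⁻¹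
    rw [mul_inv_rev', mul_inv_rev']
    exact ρ.2 a⁻¹ _ _ h⟩
  left_inv ρ := Subtype.ext <| Setoid.ext fun x y => by
    change ρ.1 x⁻¹⁻¹ y⁻¹⁻¹ ↔ _
    rw [inv_inv', inv_inv']
  right_inv ρ := Subtype.ext <| Setoid.ext fun x y => by
    change ρ.1 x⁻¹⁻¹ y⁻¹⁻¹ ↔ _
    rw [inv_inv', inv_inv']
  map_rel_iff' := by
    intro ρ σ
    constructor
    · intro h x y hxy
      have := @h x⁻¹ y⁻¹ (by
        change ρ.1 x⁻¹⁻¹ y⁻¹⁻¹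
        rwa [inv_inv', inv_inv'])
      change σ.1 x⁻¹⁻¹ y⁻¹⁻¹ at this
      rwa [inv_inv', inv_inv'] at this
    · exact fun h x y hxy => h hxy

theorem subsingleton_schutzenbergerGroup (hH : IsHTrivial S) (x : S) :
    Subsingleton (schutzenbergerGroup x) := by
  refine ⟨fun σ τ => Subtype.ext (Equiv.ext fun y => Subtype.ext ?_)⟩
  exact hH _ _ ((greenH S).trans (σ.1 y).2 ((greenH S).symm (τ.1 y).2))

theorem sum_idempotents [Fintype (DClass S)] [Fintype (idempotents S)]
    (F : DClass S → Cardinal.{u}) :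
    ∑ e : idempotents S, F (Quotient.mk (greenD S) (e : S))
      = ∑ r, Cardinal.mk (idempotentsIn r) * F r := by
  classical
  let c : idempotents S → DClass S := fun e => Quotient.mk (greenD S) (e : S)
  rw [← Finset.sum_fiberwise' Finset.univ c F]
  refine Finset.sum_congr rfl fun r _ => ?_
  rw [Finset.sum_const, nsmul_eq_mul]
  congr 1
  let E : idempotentsIn r ≃ {e : idempotents S // c e = r} :=
    { toFun := fun e => ⟨⟨e, e.2.1⟩, e.2.2⟩
      invFun := fun e => ⟨e.1, e.1.2, e.2⟩
      left_inv := fun _ => rfl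
      right_inv := fun _ => rfl }
  rw [Cardinal.mk_congr E, Cardinal.mk_fintype, Fintype.card_subtype]

end Assembly

end SemigroupHeight

theorem mainTheorem10 {S : Type u} [Semigroup S] [Nonempty S] (hS : IsInverseSemigroup S)
    [Fintype (DClass S)]
    (h : DClass S → S) (hh : ∀ r : DClass S, (Quotient.mk (greenD S) (h r) : DClass S) = r) :
    ((∀ r : DClass S, (idempotentsIn r).Finite) →
      height (LCong S) =
          ∑ r : DClass S, Cardinal.mk (idempotentsIn r) *
            height (Subgroup (schutzenbergerGroup (h r))) ∧
      height (RCong S) =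
          ∑ r : DClass S, Cardinal.mk (idempotentsIn r) *
            height (Subgroup (schutzenbergerGroup (h r))) ∧
      (IsHTrivial S →
        height (LCong S) = Cardinal.mk (idempotents S) ∧
        height (RCong S) = Cardinal.mk (idempotents S))) ∧
    (IsStable S →
      height (Con S) = ∑ r : DClass S, height (NSub (schutzenbergerGroup (h r))) ∧
      (IsHTrivial S → height (Con S) = Cardinal.mk (DClass S))) := by
  let _ := hS.inverseSemigroup
  constructor
  · intro hfin
    have hE : (idempotents S).Finite := by
      refine (Set.finite_iUnion hfin).subset fun e he => Set.mem_iUnion.2 ⟨_, he, rfl⟩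
    let _ : Fintype (idempotents S) := hE.fintype
    let c : idempotents S → DClass S := fun e => Quotient.mk (greenD S) (e : S)
    -- Base points in the `L`-classes, all in the `R`-class of the chosen element of the `D`-class.
    have hb : ∀ e : idempotents S, ∃ b : S, b⁻¹ * b = e ∧ h (c e) * (h (c e))⁻¹ = b * b⁻¹ := by
      intro e
      have he : (e : S) * e = e := e.2
      obtain ⟨b, h1, h2⟩ := greenD_iff.1 (Quotient.exact (hh (c e)).symm : greenD S (e : S) _)
      exact ⟨b, by rw [h1, inv_eq_self he, he], h2.symm⟩
    choose b hb1 hb2 using hb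
    have hL : height (LCong S)
        = ∑ e : idempotents S, height (Subgroup (schutzenbergerGroup (h (c e)))) :=
      height_LCong b hb1 _ fun e => hb2 e ▸ schutzenbergerEquiv (h (c e))
    have hR : height (RCong S) = height (LCong S) := height_congr rCongOrderIso
    have hsum := sum_idempotents fun r => height (Subgroup (schutzenbergerGroup (h r)))
    rw [hR, hL]
    refine ⟨hsum, hsum, fun hH => ?_⟩
    have h1 : ∑ e : idempotents S, height (Subgroup (schutzenbergerGroup (h (c e))))
        = Cardinal.mk (idempotents S) := by
      have h2 : ∀ e : idempotents S, height (Subgroup (schutzenbergerGroup (h (c e)))) = 1 :=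
        fun e => by
          have := subsingleton_schutzenbergerGroup hH (h (c e))
          exact height_of_subsingleton
      simp [h2]
    exact ⟨h1, h1⟩
  · intro hst
    have hf : ∀ r, (Quotient.mk (greenD S) (h r * (h r)⁻¹) : DClass S) = r := fun r => by
      refine (Quotient.sound ?_).trans (hh r)
      refine (le_sup_right : greenR S ≤ greenD S) (greenR_iff.2 ?_)
      rw [inv_eq_self (mul_inv_idem _), mul_inv_idem]
    have hC := height_Con hst (fun r => h r * (h r)⁻¹) hf _ fun r => schutzenbergerEquiv (h r)
    refine ⟨hC, fun hH => ?_⟩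
    have h2 : ∀ r, height (NSub (schutzenbergerGroup (h r))) = 1 := fun r => by
      have := subsingleton_schutzenbergerGroup hH (h r)
      have : Nonempty (NSub (schutzenbergerGroup (h r))) := ⟨⊤⟩
      exact height_of_subsingleton
    rw [hC]
    simp [h2]
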